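/- Let $\mathbb S^2\subset\mathbb R^3$ be the unit sphere with its round metric $g$ and Levi-Civita connection $\nabla$, and let $p>0$, $q\ge 0$ be real numbers. For a smooth vector field $\sigma$ on $\mathbb S^2$, let $$E^v(\sigma)=\tfrac12\int_{\mathbb S^2}|d^v\sigma|^2\,v_g,\qquad |d^v\sigma|^2=(1+|\sigma|^2)^{-p}\sum_{i=1}^{2}\Big(|\nabla_{e_i}\sigma|^2+q\,g(\nabla_{e_i}\sigma,\sigma)^2\Big)$$ ($\{e_1,e_2\}$ a local orthonormal frame) be its vertical energy with respect to the generalised Cheeger-Gromoll metric $h_{p,q}$ on $T\mathbb S^2$. The field $\sigma$ is called $(p,q)$-harmonic if it is a critical point of $E^v$ with respect to smooth variations through vector fields, or, in terms of the Euler-Lagrange equation, if $$(1+|\sigma|^2)\nabla^*\nabla\sigma+2p\,\nabla_{X(\sigma)}\sigma=\Big[p|\nabla\sigma|^2-pq|X(\sigma)|^2-q(1+|\sigma|^2)\,\Delta\big(\tfrac12|\sigma|^2\big)\Big]\sigma ,$$ where $\nabla^*\nabla\sigma=-\operatorname{trace}\nabla^2\sigma$, $\Delta f=-\operatorname{div}\operatorname{grad}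 f$ and $X(\sigma)=\operatorname{grad}(\tfrac12|\sigma|^2)$. Then there is no non-zero $(p,q)$-harmonic Killing vector field on $\mathbb S^2$, in either sense: no non-zero smooth Killing vector field on $\mathbb S^2$ is a critical point of $E^v$ with respect to smooth variations through vector fields, and none satisfies the displayed equation. -/

import Mathlib

open scoped Manifold ContDiff InnerProductSpace

noncomputable section

namespace RoundSphere

/-- Euclidean three-space. -/
abbrev E3 : Type := EuclideanSpace ℝ (Fin 3)

/-- The unit sphere in Euclidean three-space, with Mathlib's smooth structure. Its round metric is
the one induced from `E3`: the tangent space at `x` is the plane `(ℝ ∙ x)ᗮ` with the inner product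
of `E3`. -/
abbrev S2 : Type := Metric.sphere (0 : E3) 1

/-- A smooth (tangent) vector field on the sphere: a smooth map `σ` into `E3` such that `σ x` is
orthogonal to `x`. -/
structure IsVectorField (σ : S2 → E3) : Prop where
  smooth : ContMDiff (𝓡 2) 𝓘(ℝ, E3) ∞ σ
  tangent : ∀ x : S2, ⟪(x : E3), σ x⟫_ℝ = 0

/-- The composition `f ∘ r`, where `r y = y / ‖y‖` is the radial retraction onto the sphere (the
value at the origin is irrelevant). As `r` is smooth off the origin, and its derivative at a point
`x` of the sphere is the orthogonal projection onto the tangent plane at `x`, the derivative of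
`f ∘ r` at `x` is the differential of `f` on tangent vectors, and vanishes on normal vectors. -/
def radialExtension {F : Type*} [Zero F] (f : S2 → F) (y : E3) : F :=
  open Classical in
  if h : y = 0 then 0 else
    f ⟨‖y‖⁻¹ • y, by
      rw [mem_sphere_zero_iff_norm, norm_smul, norm_inv, norm_norm,
        inv_mul_cancel₀ (norm_ne_zero_iff.mpr h)]⟩

/-- The Levi-Civita connection of the round metric: `nabla σ x X` is `∇_X σ` at `x`, that is, the
tangential component of the derivative of `σ` in the direction `X`. For a vector `X` of `E3` that
is not tangent, this is the covariant derivative along the tangential component of `X`. -/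
def nabla (σ : S2 → E3) (x : S2) : E3 →L[ℝ] E3 :=
  (ℝ ∙ (x : E3))ᗮ.starProjection ∘L fderiv ℝ (radialExtension σ) (x : E3)

/-- The Riemannian gradient of a function on the sphere. -/
def grad (f : S2 → ℝ) (x : S2) : E3 := gradient (radialExtension f) (x : E3)

/-- The standard orthonormal basis of `E3`. -/
def stdVec (i : Fin 3) : E3 := EuclideanSpace.basisFun (Fin 3) ℝ i

/-- The tangential components `E₁, E₂, E₃` of the standard basis of `E3`, as vector fields. -/
def stdField (i : Fin 3) (x : S2) : E3 := (ℝ ∙ (x : E3))ᗮ.starProjection (stdVec i)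

/-- Traces over a tangent plane may be computed with the fields `E₁, E₂, E₃`: for every orthonormal
basis `b` of the tangent plane at `x` and every bilinear map `B`, one has
`∑ i, B (E i) (E i) = ∑ j, B (b j) (b j)`. -/
theorem sum_stdField_eq_sum_orthonormalBasis {F : Type*} [AddCommGroup F] [Module ℝ F] (x : S2)
    (b : OrthonormalBasis (Fin 2) ℝ (ℝ ∙ (x : E3))ᗮ) (B : E3 →ₗ[ℝ] E3 →ₗ[ℝ] F) :
    ∑ i, B (stdField i x) (stdField i x) = ∑ j, B (b j : E3) (b j : E3) := by
  have key : ∀ i, stdField i x = ∑ j, ⟪(b j : E3), stdVec i⟫_ℝ • (b j : E3) := by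
    intro i
    have h := b.sum_repr' ((ℝ ∙ (x : E3))ᗮ.orthogonalProjectionOnto (stdVec i))
    have h2 := congrArg (fun v : (ℝ ∙ (x : E3))ᗮ => (v : E3)) h
    simp only [Submodule.coe_sum, Submodule.coe_smul,
      Submodule.inner_orthogonalProjectionOnto_eq_of_mem_left] at h2
    exact h2.symm
  have hb : ∀ j k, ∑ i, ⟪(b j : E3), stdVec i⟫_ℝ * ⟪(b k : E3), stdVec i⟫_ℝ
      = if j = k then 1 else 0 := by
    intro j k
    have h := (EuclideanSpace.basisFun (Fin 3) ℝ).sum_inner_mul_inner (b j : E3) (b k : E3)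
    have h3 := orthonormal_iff_ite.mp b.orthonormal j k
    rw [← h3, Submodule.coe_inner, ← h]
    refine Finset.sum_congr rfl fun i _ => ?_
    rw [stdVec, real_inner_comm (b k : E3)]
  calc ∑ i, B (stdField i x) (stdField i x)
      = ∑ i, ∑ j, ∑ k, (⟪(b j : E3), stdVec i⟫_ℝ * ⟪(b k : E3), stdVec i⟫_ℝ) •
          B (b j : E3) (b k : E3) := by
        refine Finset.sum_congr rfl fun i _ => ?_
        rw [key i]
        simp only [map_sum, map_smul, LinearMap.sum_apply, LinearMap.smul_apply, Finset.smul_sum,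
          smul_smul]
        rw [Finset.sum_comm]
        refine Finset.sum_congr rfl fun j _ => Finset.sum_congr rfl fun k _ => ?_
        rw [mul_comm]
    _ = ∑ j, ∑ k, (∑ i, ⟪(b j : E3), stdVec i⟫_ℝ * ⟪(b k : E3), stdVec i⟫_ℝ) •
          B (b j : E3) (b k : E3) := by
        rw [Finset.sum_comm]
        refine Finset.sum_congr rfl fun j _ => ?_
        rw [Finset.sum_comm]
        simp only [Finset.sum_smul]
    _ = ∑ j, B (b j : E3) (b j : E3) := by
        simp [hb]

/-- `|∇σ|²`, the squared Hilbert-Schmidt norm of `X ↦ ∇_X σ` on the tangent plane at `x`. -/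
def normSqNabla (σ : S2 → E3) (x : S2) : ℝ := ∑ i, ‖nabla σ x (stdField i x)‖ ^ 2

/-- The second covariant derivative `∇²_{X,Y} σ = ∇_X (∇_Y σ) - ∇_{∇_X Y} σ` for vector fields
`X` and `Y`. -/
def nabla2 (σ X Y : S2 → E3) (x : S2) : E3 :=
  nabla (fun y => nabla σ y (Y y)) x (X x) - nabla σ x (nabla Y x (X x))

/-- The rough Laplacian `∇^*∇σ = - trace ∇²σ`. -/
def roughLaplacian (σ : S2 → E3) (x : S2) : E3 := - ∑ i, nabla2 σ (stdField i) (stdField i) x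

/-- The Laplacian on functions with the same sign convention, `Δf = - div grad f`. -/
def laplacian (f : S2 → ℝ) (x : S2) : ℝ :=
  - ∑ i, ⟪nabla (grad f) x (stdField i x), stdField i x⟫_ℝ

/-- The vector field `X(σ) = grad (|σ|² / 2)`. -/
def gradHalfNormSq (σ : S2 → E3) (x : S2) : E3 := grad (fun y => ‖σ y‖ ^ 2 / 2) x

/-- Killing vector fields: `g(∇_X σ, Y) + g(X, ∇_Y σ) = 0` for all tangent vectors `X`, `Y`
(that is, the Lie derivative of the metric along `σ` vanishes). -/
def IsKilling (σ : S2 → E3) : Prop :=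
  ∀ x : S2, ∀ X ∈ (ℝ ∙ (x : E3))ᗮ, ∀ Y ∈ (ℝ ∙ (x : E3))ᗮ,
    ⟪nabla σ x X, Y⟫_ℝ + ⟪X, nabla σ x Y⟫_ℝ = 0

/-- The generalised Cheeger-Gromoll metric `h_{p,q}` on vertical vectors at the point `e` of the
tangent bundle, these being identified with tangent vectors by the connection map:
`(1 + |e|²)^(-p) (g(A, B) + q g(A, e) g(B, e))`. -/
def verticalMetric (p q : ℝ) (e A B : E3) : ℝ :=
  ((1 + ‖e‖ ^ 2)⁻¹) ^ p * (⟪A, B⟫_ℝ + q * ⟪A, e⟫_ℝ * ⟪B, e⟫_ℝ)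

/-- `|d^v σ|²`: the vertical part of `dσ(X)` is identified by the connection map with `∇_X σ`. -/
def normSqVerticalDiff (p q : ℝ) (σ : S2 → E3) (x : S2) : ℝ :=
  ∑ i, verticalMetric p q (σ x) (nabla σ x (stdField i x)) (nabla σ x (stdField i x))

/-- The area measure of the round unit sphere. -/
def area : MeasureTheory.Measure S2 := (MeasureTheory.volume : MeasureTheory.Measure E3).toSphere

/-- The vertical energy `E^v(σ) = 1/2 ∫ |d^v σ|²`. -/
def verticalEnergy (p q : ℝ) (σ : S2 → E3) : ℝ :=
  1 / 2 * ∫ x, normSqVerticalDiff p q σ x ∂area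

/-- A smooth variation of `σ` through vector fields. -/
structure IsVariation (σ : S2 → E3) (Φ : ℝ → S2 → E3) : Prop where
  smooth : ContMDiff (𝓘(ℝ, ℝ).prod (𝓡 2)) 𝓘(ℝ, E3) ∞ (fun z : ℝ × S2 => Φ z.1 z.2)
  tangent : ∀ (t : ℝ) (x : S2), ⟪(x : E3), Φ t x⟫_ℝ = 0
  start : Φ 0 = σ

/-- `σ` is a critical point of the vertical energy with respect to variations through sections. -/
def IsCriticalSection (p q : ℝ) (σ : S2 → E3) : Prop :=
  ∀ Φ : ℝ → S2 → E3, IsVariation σ Φ → HasDerivAt (fun t => verticalEnergy p q (Φ t)) 0 0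

/-- `σ` solves the Euler-Lagrange equation of the vertical energy,
`(1 + |σ|²) ∇^*∇σ + 2p ∇_{X(σ)} σ
  = [p |∇σ|² - p q |X(σ)|² - q (1 + |σ|²) Δ(|σ|² / 2)] σ`. -/
def SolvesEulerLagrange (p q : ℝ) (σ : S2 → E3) : Prop :=
  ∀ x : S2,
    (1 + ‖σ x‖ ^ 2) • roughLaplacian σ x + (2 * p) • nabla σ x (gradHalfNormSq σ x) =
      (p * normSqNabla σ x - p * q * ‖gradHalfNormSq σ x‖ ^ 2
        - q * (1 + ‖σ x‖ ^ 2) * laplacian (fun y => ‖σ y‖ ^ 2 / 2) x) • σ x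

end RoundSphere

end

namespace RoundSphere

/-! A Killing field on the sphere is the restriction of a skew map `A`, say `v ↦ a × v`
(`IsKilling.exists_skew`). The field extends homogeneously of degree one to a map whose derivatives
are all skew; its second derivative is then symmetric in two arguments and alternating in two, hence
zero.

With `s = ‖A x‖²` and `m = |a|²`, direct computation gives `∇^*∇σ = σ`, `|∇σ|² = 2(m - s)`, `|X(σ)|²
= s(m - s)` and `Δ(|σ|²/2) = 3s - 2m`. On the equator `s = m` the Euler-Lagrange equation reduces to
`(1 + m)(1 + q m) = 0`, which is impossible if `A ≠ 0`.

Criticality is refuted directly, without deriving the equation. Along `(1 + t exp(p s)) σ` the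
energy density is `m - s` times an explicit function of `t` and `s`. Growth of `exp(p s)` outweighs
decay of the weight `(1 + |σ|²)^(-p)`, so the `t`-derivative at `0` is positive wherever `s < m`,
and the energy has positive derivative. -/

/-! ### Radial extension and its derivative -/

theorem starProjection_tangent_apply (x : S2) (v : E3) :
    (ℝ ∙ (x : E3))ᗮ.starProjection v = v - ⟪(x : E3), v⟫_ℝ • (x : E3) := by
  have hx : ‖(x : E3)‖ = 1 := by simp
  rw [Submodule.starProjection_orthogonal, sub_apply,
    Submodule.starProjection_unit_singleton ℝ hx]
  rfl

theorem inner_coe_self (x : S2) : ⟪(x : E3), (x : E3)⟫_ℝ = 1 := by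
  rw [real_inner_self_eq_norm_sq]; simp

theorem radialExtension_of_ne {F : Type*} [Zero F] (f : S2 → F) {y : E3} (hy : y ≠ 0)
    {x : S2} (hx : (x : E3) = ‖y‖⁻¹ • y) : radialExtension f y = f x := by
  rw [radialExtension, dif_neg hy]
  congr 1
  exact Subtype.ext hx.symm

theorem hasFDerivAt_normalize (x : S2) :
    HasFDerivAt (fun y : E3 => ‖y‖⁻¹ • y) ((ℝ ∙ (x : E3))ᗮ.starProjection) (x : E3) := by
  have hx : ‖(x : E3)‖ = 1 := by simp
  have h1 : HasFDerivAt (fun y : E3 => ‖y‖ ^ 2) (2 • innerSL ℝ (x : E3)) (x : E3) :=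
    (hasStrictFDerivAt_norm_sq (x : E3)).hasFDerivAt
  have h2 := (hasDerivAt_inv (by simp)).comp_hasFDerivAt (x : E3) (h1.sqrt (by simp))
  simp only [Function.comp_def, Real.sqrt_sq (norm_nonneg _)] at h2
  convert! h2.smul (hasFDerivAt_id (x : E3)) using 1
  ext1 v
  rw [starProjection_tangent_apply]
  simp [hx, sub_eq_add_neg]

/-- Off the origin the radial extension is `G` composed with normalisation. Through this chain rule
`nabla` and `grad` become computable from any ambient formula. -/
theorem hasFDerivAt_radialExtension {F : Type*} [NormedAddCommGroup F] [NormedSpace ℝ F]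
    {f : S2 → F} {G : E3 → F} (hG : ∀ y : S2, f y = G y) {x : S2} {G' : E3 →L[ℝ] F}
    (h : HasFDerivAt G G' (x : E3)) :
    HasFDerivAt (radialExtension f) (G' ∘L (ℝ ∙ (x : E3))ᗮ.starProjection) (x : E3) := by
  have hx : ‖(x : E3)‖ = 1 := by simp
  have hx0 : (x : E3) ≠ 0 := by rw [← norm_ne_zero_iff, hx]; exact one_ne_zero
  have h' : HasFDerivAt G G' (‖(x : E3)‖⁻¹ • (x : E3)) := by simpa [hx] using h
  refine (HasFDerivAt.comp (g := G) (f := fun y : E3 => ‖y‖⁻¹ • y) (x : E3) h'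
    (hasFDerivAt_normalize x)).congr_of_eventuallyEq ?_
  filter_upwards [isOpen_ne.mem_nhds hx0] with y hy
  rw [radialExtension, dif_neg hy, hG]
  rfl

theorem contDiffOn_radialExtension {σ : S2 → E3} (hσ : ContMDiff (𝓡 2) 𝓘(ℝ, E3) ∞ σ) :
    ContDiffOn ℝ ∞ (radialExtension σ) {0}ᶜ := by
  have : Fact (Module.finrank ℝ E3 = 2 + 1) := ⟨by simp⟩
  let U : TopologicalSpace.Opens E3 := ⟨{0}ᶜ, isOpen_compl_singleton⟩
  have hn : ContMDiff 𝓘(ℝ, E3) 𝓘(ℝ, E3) ∞ (fun y : U => ‖(y : E3)‖⁻¹ • (y : E3)) := by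
    intro y
    have hy : (y : E3) ≠ 0 := y.2
    refine contMDiffAt_subtype_iff (U := U) (f := fun y : E3 => ‖y‖⁻¹ • y).mpr
      (ContDiffAt.contMDiffAt ?_)
    exact ((contDiffAt_norm ℝ hy).inv (norm_ne_zero_iff.mpr hy)).smul contDiffAt_id
  have hs : ∀ y : U, ‖(y : E3)‖⁻¹ • (y : E3) ∈ Metric.sphere (0 : E3) 1 := by
    intro y
    have hy : (y : E3) ≠ 0 := y.2
    rw [mem_sphere_zero_iff_norm, norm_smul, norm_inv, norm_norm,
      inv_mul_cancel₀ (norm_ne_zero_iff.mpr hy)]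
  have hc := hσ.comp (ContMDiff.codRestrict_sphere (n := 2) hn hs)
  intro y hy
  have h1 : ContMDiffAt 𝓘(ℝ, E3) 𝓘(ℝ, E3) ∞ (fun y : U => radialExtension σ (y : E3)) ⟨y, hy⟩ := by
    convert! hc ⟨y, hy⟩ using 1
    funext z
    have hz : (z : E3) ≠ 0 := z.2
    rw [radialExtension, dif_neg hz]
    rfl
  exact (contMDiffAt_subtype_iff.mp h1).contDiffAt.contDiffWithinAt

/-! ### Killing fields are linear -/

/-- A positively homogeneous map of degree one has a homogeneous derivative of degree zero. -/
theorem fderiv_smul_of_homogeneous {F : E3 → E3} {c : ℝ} (hc : 0 < c)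
    (hF : ∀ y, F (c • y) = c • F y) (y : E3) : fderiv ℝ F (c • y) = fderiv ℝ F y := by
  have h1 : fderiv ℝ (fun z => F (c • z)) y = c • fderiv ℝ F (c • y) := fderiv_comp_smul c
  have h2 : fderiv ℝ (fun z => F (c • z)) y = c • fderiv ℝ F y := by
    rw [funext hF]
    exact congrFun (fderiv_const_smul_field (𝕜 := ℝ) (f := F) c) y
  exact smul_right_injective _ hc.ne' (h1.symm.trans h2)

/-- Euler's identity in degree one. -/
theorem fderiv_apply_self_of_homogeneous {F : E3 → E3} {y : E3} (hd : DifferentiableAt ℝ F y)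
    (hF : ∀ c : ℝ, 0 < c → F (c • y) = c • F y) : fderiv ℝ F y y = F y := by
  have hl : HasDerivAt (fun c : ℝ => c • y) y 1 := by
    simpa using (hasDerivAt_id (1 : ℝ)).smul_const y
  have h1 : HasDerivAt (fun c : ℝ => F (c • y)) (fderiv ℝ F y y) 1 := by
    have hd' : HasFDerivAt F (fderiv ℝ F y) ((1 : ℝ) • y) := by simpa using hd.hasFDerivAt
    exact hd'.comp_hasDerivAt (1 : ℝ) hl
  have hl' : HasDerivAt (fun c : ℝ => c • F y) (F y) 1 := by
    simpa using (hasDerivAt_id (1 : ℝ)).smul_const (F y)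
  refine h1.unique (hl'.congr_of_eventuallyEq ?_)
  filter_upwards [lt_mem_nhds (one_pos : (0 : ℝ) < 1)] with c hc using hF c hc

/-- A trilinear form symmetric in the first two and alternating in the last two arguments
vanishes. -/
theorem eq_zero_of_symm_of_skew {B : E3 →L[ℝ] E3 →L[ℝ] E3} (hs : ∀ u v, B u v = B v u)
    (hk : ∀ u v, ⟪B u v, v⟫_ℝ = 0) : B = 0 := by
  have hk' : ∀ u v w, ⟪B u v, w⟫_ℝ = - ⟪B u w, v⟫_ℝ := by
    intro u v w
    have h := hk u (v + w)
    simp only [map_add, inner_add_left, inner_add_right, hk] at h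
    linarith
  ext1 u
  ext1 v
  refine ext_inner_right ℝ fun w => ?_
  -- Alternating the two symmetries around the three arguments brings `⟪B u v, w⟫` back to its own
  -- negative.
  have h1 := hk' u v w
  have h2 := hk' w u v
  have h3 := hk' v w u
  rw [hs u w] at h1
  rw [hs w v] at h2
  rw [hs v u] at h3
  simp only [zero_apply, inner_zero_left]
  linarith

/-- A smooth map off the origin whose derivatives are skew has constant derivative. -/
theorem exists_fderiv_eq_of_skew {F : E3 → E3} (hF : ContDiffOn ℝ ∞ F {0}ᶜ)
    (hk : ∀ y ≠ 0, ∀ v, ⟪fderiv ℝ F y v, v⟫_ℝ = 0) :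
    ∃ A : E3 →L[ℝ] E3, ∀ y ≠ 0, fderiv ℝ F y = A := by
  have ho : IsOpen ({0}ᶜ : Set E3) := isOpen_compl_singleton
  have hc : IsPreconnected ({0}ᶜ : Set E3) := by
    refine (isConnected_compl_singleton_of_one_lt_rank ?_ 0).isPreconnected
    rw [← Module.finrank_eq_rank, finrank_euclideanSpace_fin]
    norm_num
  have hF1 : ContDiffOn ℝ 1 (fderiv ℝ F) {0}ᶜ := hF.fderiv_of_isOpen ho (by norm_cast)
  suffices h0 : Set.EqOn (fderiv ℝ (fderiv ℝ F)) 0 {0}ᶜ from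
    ho.exists_is_const_of_fderiv_eq_zero hc (hF1.differentiableOn one_ne_zero) h0
  intro y hy
  have hd : HasFDerivAt (fderiv ℝ F) (fderiv ℝ (fderiv ℝ F) y) y :=
    ((hF1.differentiableOn one_ne_zero).differentiableAt (ho.mem_nhds hy)).hasFDerivAt
  -- Symmetry is Schwarz's theorem; skewness comes from differentiating `hk` with `v` fixed.
  refine eq_zero_of_symm_of_skew ?_ ?_
  · exact (hF.contDiffAt (ho.mem_nhds hy)).isSymmSndFDerivAt
      (by rw [minSmoothness_of_isRCLikeNormedField]; norm_cast)
  · intro u v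
    have h1 := (hd.clm_apply (hasFDerivAt_const v y)).inner ℝ (hasFDerivAt_const v y)
    have h2 : HasFDerivAt (fun z => ⟪fderiv ℝ F z v, v⟫_ℝ) (0 : E3 →L[ℝ] ℝ) y := by
      refine (hasFDerivAt_const (0 : ℝ) y).congr_of_eventuallyEq ?_
      filter_upwards [ho.mem_nhds hy] with z hz using hk z hz v
    have h3 := congrArg (fun L : E3 →L[ℝ] ℝ => L u) (h1.unique h2)
    simpa using h3

/-- Killing vector fields on the round sphere are restrictions of skew endomorphisms. -/
theorem IsKilling.exists_skew {σ : S2 → E3} (hσ : IsVectorField σ) (hK : IsKilling σ) :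
    ∃ A : E3 →L[ℝ] E3, (∀ v, ⟪A v, v⟫_ℝ = 0) ∧ ∀ x : S2, σ x = A x := by
  set R := radialExtension σ with hR
  -- Degree one is forced: the linear map sought is the degree-one extension of its restriction.
  set F : E3 → E3 := fun y => ‖y‖ • R y with hFdef
  have ho : IsOpen ({0}ᶜ : Set E3) := isOpen_compl_singleton
  have hRs : ContDiffOn ℝ ∞ R {0}ᶜ := contDiffOn_radialExtension hσ.smooth
  have hF : ContDiffOn ℝ ∞ F {0}ᶜ := by
    intro y hy
    exact ((contDiffAt_norm ℝ hy).contDiffWithinAt).smul (hRs y hy)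
  have hRx : ∀ x : S2, R x = σ x := by
    intro x
    have hx : ‖(x : E3)‖ = 1 := by simp
    exact radialExtension_of_ne σ (by rw [← norm_ne_zero_iff, hx]; exact one_ne_zero)
      (by simp [hx])
  have hFx : ∀ x : S2, F x = σ x := by
    intro x
    have hx : ‖(x : E3)‖ = 1 := by simp
    simp only [hFdef, hx, one_smul, hRx]
  have hhom : ∀ c : ℝ, 0 < c → ∀ y, F (c • y) = c • F y := by
    intro c hc y
    by_cases hy : y = 0
    · simp [hFdef, hy]
    have hR' : R (c • y) = R y := by
      have hcy : c • y ≠ 0 := smul_ne_zero hc.ne' hy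
      rw [hR, radialExtension, radialExtension, dif_neg hcy, dif_neg hy]
      congr 2
      rw [norm_smul, Real.norm_of_nonneg hc.le, smul_smul]
      congr 1
      field_simp
    simp only [hFdef, hR', norm_smul, Real.norm_of_nonneg hc.le, smul_smul]
  have hdF : ∀ y ≠ 0, DifferentiableAt ℝ F y := fun y hy =>
    (hF.contDiffAt (ho.mem_nhds hy)).differentiableAt (by simp)
  have htan : ∀ y, ⟪F y, y⟫_ℝ = 0 := by
    intro y
    by_cases hy : y = 0
    · simp [hy]
    have h := hσ.tangent ⟨‖y‖⁻¹ • y, by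
      rw [mem_sphere_zero_iff_norm, norm_smul, norm_inv, norm_norm,
        inv_mul_cancel₀ (norm_ne_zero_iff.mpr hy)]⟩
    rw [← radialExtension_of_ne σ hy rfl, inner_smul_left] at h
    have h' : ⟪y, R y⟫_ℝ = 0 :=
      (mul_eq_zero.mp h).resolve_left (by simpa using hy)
    simp only [hFdef, inner_smul_left, real_inner_comm, h', mul_zero]
  -- Split `v = α x + w` with `w` tangent. Euler's identity handles `x`, differentiating `⟪F y, y⟫ =
  -- 0` makes the mixed terms cancel, and the Killing equation handles `w`.
  have hskew_sphere : ∀ x : S2, ∀ v, ⟪fderiv ℝ F x v, v⟫_ℝ = 0 := by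
    intro x v
    have hx : ‖(x : E3)‖ = 1 := by simp
    have hx0 : (x : E3) ≠ 0 := by rw [← norm_ne_zero_iff, hx]; exact one_ne_zero
    have ha : fderiv ℝ F x x = σ x := by
      rw [fderiv_apply_self_of_homogeneous (hdF _ hx0) fun c hc => hhom c hc _, hFx]
    have hb : ∀ w, ⟪fderiv ℝ F x w, (x : E3)⟫_ℝ = - ⟪σ x, w⟫_ℝ := by
      intro w
      have h1 := (hdF _ hx0).hasFDerivAt.inner ℝ (hasFDerivAt_id (x : E3))
      have h2 : HasFDerivAt (fun y => ⟪F y, y⟫_ℝ) (0 : E3 →L[ℝ] ℝ) (x : E3) := by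
        simp only [htan]
        exact hasFDerivAt_const _ _
      have h3 := congrArg (fun L : E3 →L[ℝ] ℝ => L w) (h1.unique h2)
      simp [hFx] at h3
      linarith
    have hc : ∀ w, ⟪(x : E3), w⟫_ℝ = 0 → ⟪fderiv ℝ F x w, w⟫_ℝ = 0 := by
      intro w hw
      have hdR : HasFDerivAt R (fderiv ℝ R x) (x : E3) :=
        ((hRs.contDiffAt (ho.mem_nhds hx0)).differentiableAt (by simp)).hasFDerivAt
      have hn : HasFDerivAt (fun y : E3 => ‖y‖) (fderiv ℝ (fun y : E3 => ‖y‖) x) (x : E3) :=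
        ((contDiffAt_norm ℝ (n := 1) hx0).differentiableAt one_ne_zero).hasFDerivAt
      have h1 := (hn.smul hdR).fderiv
      have hwm : w ∈ (ℝ ∙ (x : E3))ᗮ := Submodule.mem_orthogonal_singleton_iff_inner_right.mpr hw
      have h2 := hK x w hwm w hwm
      have h3 : ⟪fderiv ℝ R x w, w⟫_ℝ = 0 := by
        rw [real_inner_comm (nabla σ x w) w] at h2
        have h4 : ⟪nabla σ x w, w⟫_ℝ = 0 := by linarith
        rw [nabla, ContinuousLinearMap.comp_apply, starProjection_tangent_apply, inner_sub_left,
          inner_smul_left, hw, mul_zero, sub_zero] at h4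
        exact h4
      have hnw : fderiv ℝ (fun y : E3 => ‖y‖) x w = 0 := by
        have h5 : HasFDerivAt (fun y : E3 => ‖y‖ ^ 2) (2 • innerSL ℝ (x : E3)) (x : E3) :=
          (hasStrictFDerivAt_norm_sq (x : E3)).hasFDerivAt
        have h6 := congrArg (fun L : E3 →L[ℝ] ℝ => L w) ((hn.pow 2).unique h5)
        simpa [hx, hw] using h6
      have h7 : fderiv ℝ F x w = fderiv ℝ R x w := by
        have h8 := congrArg (fun L : E3 →L[ℝ] E3 => L w) h1
        simpa [hx, hnw] using! h8
      rw [h7, h3]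
    obtain ⟨α, w, hw, rfl⟩ : ∃ (α : ℝ) (w : E3), ⟪(x : E3), w⟫_ℝ = 0 ∧ v = α • (x : E3) + w := by
      refine ⟨⟪(x : E3), v⟫_ℝ, v - ⟪(x : E3), v⟫_ℝ • (x : E3), ?_, by simp⟩
      rw [inner_sub_right, inner_smul_right, inner_coe_self]
      ring
    have h0 := hσ.tangent x
    rw [real_inner_comm] at h0
    simp only [map_add, map_smul, inner_add_left, inner_add_right, inner_smul_left,
      inner_smul_right, ha, hb, hc w hw, h0]
    simp
  have hskew : ∀ y ≠ 0, ∀ v, ⟪fderiv ℝ F y v, v⟫_ℝ = 0 := by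
    intro y hy v
    have hy' : 0 < ‖y‖⁻¹ := inv_pos.mpr (norm_pos_iff.mpr hy)
    have h := hskew_sphere ⟨‖y‖⁻¹ • y, by
      rw [mem_sphere_zero_iff_norm, norm_smul, norm_inv, norm_norm,
        inv_mul_cancel₀ (norm_ne_zero_iff.mpr hy)]⟩ v
    rwa [fderiv_smul_of_homogeneous hy' (hhom _ hy')] at h
  obtain ⟨A, hA⟩ := exists_fderiv_eq_of_skew hF hskew
  refine ⟨A, ?_, ?_⟩
  · intro v
    by_cases hv : v = 0
    · simp [hv]
    rw [← hA v hv]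
    exact hskew v hv v
  · intro x
    have hx : ‖(x : E3)‖ = 1 := by simp
    have hx0 : (x : E3) ≠ 0 := by rw [← norm_ne_zero_iff, hx]; exact one_ne_zero
    rw [← hFx, ← hA _ hx0]
    exact (fderiv_apply_self_of_homogeneous (hdF _ hx0) fun c hc => hhom c hc _).symm

/-! ### Covariant calculus from ambient extensions -/

theorem stdField_apply (i : Fin 3) (x : S2) :
    stdField i x = stdVec i - ⟪(x : E3), stdVec i⟫_ℝ • (x : E3) :=
  starProjection_tangent_apply x _

theorem inner_coe_stdField (i : Fin 3) (x : S2) : ⟪(x : E3), stdField i x⟫_ℝ = 0 :=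
  Submodule.mem_orthogonal_singleton_iff_inner_right.mp (Submodule.starProjection_apply_mem _ _)

theorem starProjection_of_tangent (x : S2) {v : E3} (hv : ⟪(x : E3), v⟫_ℝ = 0) :
    (ℝ ∙ (x : E3))ᗮ.starProjection v = v := by
  rw [starProjection_tangent_apply, hv, zero_smul, sub_zero]

theorem sum_inner_stdVec_smul (v : E3) : ∑ i, ⟪v, stdVec i⟫_ℝ • stdVec i = v := by
  simpa [stdVec, real_inner_comm] using! (EuclideanSpace.basisFun (Fin 3) ℝ).sum_repr' v

theorem sum_inner_stdVec_mul (v w : E3) : ∑ i, ⟪v, stdVec i⟫_ℝ * ⟪w, stdVec i⟫_ℝ = ⟪v, w⟫_ℝ := by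
  rw [← (EuclideanSpace.basisFun (Fin 3) ℝ).sum_inner_mul_inner v w]
  simp only [stdVec, real_inner_comm]

theorem norm_sq_stdVec (i : Fin 3) : ⟪stdVec i, stdVec i⟫_ℝ = 1 := by
  simp [stdVec]

/-- The connection computed from any extension of the field to the ambient space. -/
theorem nabla_apply_of_hasFDerivAt {σ : S2 → E3} {G : E3 → E3} (hG : ∀ y : S2, σ y = G y) {x : S2}
    {G' : E3 →L[ℝ] E3} (h : HasFDerivAt G G' (x : E3)) {v : E3} (hv : ⟪(x : E3), v⟫_ℝ = 0) :
    nabla σ x v = G' v - ⟪(x : E3), G' v⟫_ℝ • (x : E3) := by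
  rw [nabla, (hasFDerivAt_radialExtension hG h).fderiv, ContinuousLinearMap.comp_apply,
    ContinuousLinearMap.comp_apply, starProjection_of_tangent x hv, starProjection_tangent_apply]

/-- The gradient computed from any extension of the function to the ambient space. -/
theorem grad_apply_of_hasFDerivAt {f : S2 → ℝ} {G : E3 → ℝ} (hG : ∀ y : S2, f y = G y) {x : S2}
    {w : E3} (h : HasFDerivAt G (innerSL ℝ w) (x : E3)) :
    grad f x = w - ⟪(x : E3), w⟫_ℝ • (x : E3) := by
  have h1 := hasFDerivAt_radialExtension hG h
  rw [grad]
  refine HasGradientAt.gradient ?_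
  rw [hasGradientAt_iff_hasFDerivAt]
  convert! h1 using 1
  ext1 v
  simp only [ContinuousLinearMap.comp_apply, InnerProductSpace.toDual_apply_apply,
    innerSL_apply_apply, starProjection_tangent_apply, inner_sub_left, inner_sub_right, inner_smul_left,
    inner_smul_right, real_inner_comm (x : E3) w]
  simp [mul_comm]

/-! ### Algebra of skew endomorphisms -/

section Skew

variable {A : E3 →L[ℝ] E3}

theorem inner_skew (hA : ∀ v, ⟪A v, v⟫_ℝ = 0) (v w : E3) : ⟪A v, w⟫_ℝ = - ⟪v, A w⟫_ℝ := by
  have h := hA (v + w)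
  simp only [map_add, inner_add_left, inner_add_right, hA] at h
  rw [real_inner_comm (A w) v]
  linarith

/-- A skew endomorphism of Euclidean three-space is `v ↦ a × v`; here `m = |a|²`. -/
theorem exists_skew_invariant (hA : ∀ v, ⟪A v, v⟫_ℝ = 0) :
    ∃ m : ℝ, ∑ i, ‖A (stdVec i)‖ ^ 2 = 2 * m ∧ ∀ v, ‖A (A v)‖ ^ 2 = m * ‖A v‖ ^ 2 := by
  set M : Fin 3 → Fin 3 → ℝ := fun i j => A (stdVec j) i with hM
  have hMi : ∀ i j, M i j = ⟪A (stdVec j), stdVec i⟫_ℝ := by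
    intro i j
    simp [hM, stdVec, EuclideanSpace.inner_single_right]
  have hskew : ∀ i j, M i j = - M j i := by
    intro i j
    rw [hMi, hMi, inner_skew hA, real_inner_comm]
  have hdiag : ∀ i, M i i = 0 := fun i => by linarith [hskew i i]
  have hAv : ∀ v i, A v i = ∑ j, M i j * v j := by
    intro v i
    have hv : v = ∑ j, v j • stdVec j := by
      conv_lhs => rw [← sum_inner_stdVec_smul v]
      simp [stdVec, EuclideanSpace.inner_single_right]
    conv_lhs => rw [hv]
    simp [hM, mul_comm]
  -- Up to sign, these entries are the three components of `a`.
  refine ⟨M 1 0 ^ 2 + M 2 0 ^ 2 + M 2 1 ^ 2, ?_, fun v => ?_⟩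
  · simp only [EuclideanSpace.norm_sq_eq, Real.norm_eq_abs, sq_abs, Fin.sum_univ_three]
    change M 0 0 ^ 2 + M 1 0 ^ 2 + M 2 0 ^ 2 + (M 0 1 ^ 2 + M 1 1 ^ 2 + M 2 1 ^ 2)
      + (M 0 2 ^ 2 + M 1 2 ^ 2 + M 2 2 ^ 2) = _
    rw [hdiag, hdiag, hdiag, hskew 0 1, hskew 0 2, hskew 1 2]
    ring
  · simp only [EuclideanSpace.norm_sq_eq, Real.norm_eq_abs, sq_abs, Fin.sum_univ_three, hAv]
    rw [hdiag, hdiag, hdiag, hskew 0 1, hskew 0 2, hskew 1 2]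
    ring

theorem inner_coe_skew (hA : ∀ v, ⟪A v, v⟫_ℝ = 0) (v : E3) : ⟪v, A v⟫_ℝ = 0 := by
  rw [real_inner_comm, hA]

theorem apply_stdField (i : Fin 3) (x : S2) :
    A (stdField i x) = A (stdVec i) - ⟪(x : E3), stdVec i⟫_ℝ • A x := by
  rw [stdField_apply, map_sub, map_smul]

theorem sum_inner_apply_stdVec (hA : ∀ v, ⟪A v, v⟫_ℝ = 0) (v w : E3) :
    ∑ i, ⟪v, stdVec i⟫_ℝ * ⟪A (stdVec i), w⟫_ℝ = - ⟪v, A w⟫_ℝ := by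
  have h : ∀ i, ⟪A (stdVec i), w⟫_ℝ = - ⟪A w, stdVec i⟫_ℝ := fun i => by
    rw [inner_skew hA, real_inner_comm]
  simp only [h, mul_neg, Finset.sum_neg_distrib, sum_inner_stdVec_mul]

theorem sum_norm_sq_apply_stdField (hA : ∀ v, ⟪A v, v⟫_ℝ = 0) (x : S2) :
    ∑ i, ‖A (stdField i x)‖ ^ 2 = ∑ i, ‖A (stdVec i)‖ ^ 2 - ‖A x‖ ^ 2 := by
  have h : ∀ i, ‖A (stdField i x)‖ ^ 2 = ‖A (stdVec i)‖ ^ 2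
      - 2 * (⟪(x : E3), stdVec i⟫_ℝ * ⟪A (stdVec i), A x⟫_ℝ)
      + ⟪(x : E3), stdVec i⟫_ℝ * ⟪(x : E3), stdVec i⟫_ℝ * ‖A x‖ ^ 2 := by
    intro i
    simp only [apply_stdField, ← real_inner_self_eq_norm_sq, inner_sub_left, inner_sub_right,
      inner_smul_left, inner_smul_right, real_inner_comm (A (stdVec i)) (A x)]
    simp
    ring
  simp only [h, Finset.sum_add_distrib, Finset.sum_sub_distrib, ← Finset.mul_sum, ← Finset.sum_mul,
    sum_inner_stdVec_mul, inner_coe_self, sum_inner_apply_stdVec hA]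
  rw [← inner_skew hA, real_inner_self_eq_norm_sq]
  ring

theorem inner_apply_stdField_self (hA : ∀ v, ⟪A v, v⟫_ℝ = 0) (i : Fin 3) (x : S2) :
    ⟪(x : E3), A (stdField i x)⟫_ℝ = - ⟪A x, stdVec i⟫_ℝ := by
  rw [apply_stdField, inner_sub_right, inner_smul_right, inner_coe_skew hA, mul_zero, sub_zero,
    inner_skew hA, neg_neg]

/-- By skewness the sum is the squared length of the tangential part of `A (A x)`, whose normal
component is `-‖A x‖²`. -/
theorem sum_inner_apply_stdField_sq (hA : ∀ v, ⟪A v, v⟫_ℝ = 0) (x : S2) :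
    ∑ i, ⟪A (stdField i x), A x⟫_ℝ ^ 2 = ‖A (A x)‖ ^ 2 - (‖A x‖ ^ 2) ^ 2 := by
  have h : ∀ i, ⟪A (stdField i x), A x⟫_ℝ ^ 2 = ⟪A (A x), stdVec i⟫_ℝ * ⟪A (A x), stdVec i⟫_ℝ
      + 2 * (⟪(x : E3), stdVec i⟫_ℝ * ⟪A (A x), stdVec i⟫_ℝ) * ‖A x‖ ^ 2
      + ⟪(x : E3), stdVec i⟫_ℝ * ⟪(x : E3), stdVec i⟫_ℝ * (‖A x‖ ^ 2) ^ 2 := by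
    intro i
    rw [apply_stdField, inner_sub_left, inner_smul_left, real_inner_self_eq_norm_sq,
      inner_skew hA, real_inner_comm (A (A x))]
    simp
    ring
  simp only [h, Finset.sum_add_distrib, ← Finset.mul_sum, ← Finset.sum_mul,
    sum_inner_stdVec_mul, inner_coe_self]
  have h2 : ⟪(x : E3), A (A x)⟫_ℝ = - ‖A x‖ ^ 2 := by
    rw [← real_inner_self_eq_norm_sq, inner_skew hA, neg_neg]
  rw [h2, real_inner_self_eq_norm_sq]
  ring

end Skew

/-! ### The Euler-Lagrange equation for linear fields -/

section Skew

variable {A : E3 →L[ℝ] E3} {σ : S2 → E3}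

theorem nabla_linear (hσ : ∀ x : S2, σ x = A x) (x : S2) {v : E3} (hv : ⟪(x : E3), v⟫_ℝ = 0) :
    nabla σ x v = A v - ⟪(x : E3), A v⟫_ℝ • (x : E3) :=
  nabla_apply_of_hasFDerivAt hσ A.hasFDerivAt hv

theorem hasFDerivAt_inner_const (w x : E3) :
    HasFDerivAt (fun y : E3 => ⟪y, w⟫_ℝ) (innerSL ℝ w) x := by
  convert! (innerSL ℝ w).hasFDerivAt using 1
  funext y
  rw [innerSL_apply_apply, real_inner_comm]

/-- `E i` is the gradient of a linear function, whose Hessian on the sphere is minus the function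
times the metric. -/
theorem nabla_stdField (i : Fin 3) (x : S2) {v : E3} (hv : ⟪(x : E3), v⟫_ℝ = 0) :
    nabla (stdField i) x v = - ⟪(x : E3), stdVec i⟫_ℝ • v := by
  have h : HasFDerivAt (fun y : E3 => stdVec i - ⟪y, stdVec i⟫_ℝ • y) _ (x : E3) :=
    ((hasFDerivAt_inner_const (stdVec i) x).smul (hasFDerivAt_id (x : E3))).const_sub (stdVec i)
  rw [nabla_apply_of_hasFDerivAt (stdField_apply i) h hv]
  simp [inner_add_right, inner_smul_right, hv]

/-- The terms in the tangential part of `A (E i)` cancel against the correction `∇_{∇_{E i} E i} σ`.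
-/
theorem nabla2_linear (hA : ∀ v, ⟪A v, v⟫_ℝ = 0) (hσ : ∀ x : S2, σ x = A x) (i : Fin 3) (x : S2) :
    nabla2 σ (stdField i) (stdField i) x =
      ⟪A x, stdVec i⟫_ℝ • stdField i x - ⟪stdVec i, stdField i x⟫_ℝ • A x := by
  have hG : ∀ y : S2, nabla σ y (stdField i y) =
      A (stdVec i) - ⟪(y : E3), stdVec i⟫_ℝ • A y + ⟪A y, stdVec i⟫_ℝ • (y : E3) := by
    intro y
    rw [nabla_linear hσ y (inner_coe_stdField i y), inner_apply_stdField_self hA, apply_stdField]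
    module
  have h : HasFDerivAt (fun y : E3 => A (stdVec i) - ⟪y, stdVec i⟫_ℝ • A y
      + ⟪A y, stdVec i⟫_ℝ • y) _ (x : E3) :=
    (((hasFDerivAt_inner_const (stdVec i) x).smul A.hasFDerivAt).const_sub (A (stdVec i))).add
      (((hasFDerivAt_inner_const (stdVec i) (A x)).comp (x : E3) A.hasFDerivAt).smul
        (hasFDerivAt_id (x : E3)))
  have hv := inner_coe_stdField i x
  rw [nabla2, nabla_apply_of_hasFDerivAt hG h hv, nabla_stdField i x hv,
    nabla_linear hσ x (by rw [inner_smul_right, hv, mul_zero])]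
  simp [inner_add_right, inner_smul_right, hv, inner_coe_skew hA]
  module

theorem inner_stdVec_stdField (i : Fin 3) (x : S2) :
    ⟪stdVec i, stdField i x⟫_ℝ = 1 - ⟪(x : E3), stdVec i⟫_ℝ * ⟪(x : E3), stdVec i⟫_ℝ := by
  rw [stdField_apply, inner_sub_right, inner_smul_right, norm_sq_stdVec,
    real_inner_comm (x : E3) (stdVec i)]

/-- The trace of `∇²σ` is `A x - 2 • A x`, the `2` being `∑ i, ⟪e i, E i⟫`. This is the Killing
identity `∇^*∇σ = Ric σ`. -/
theorem roughLaplacian_linear (hA : ∀ v, ⟪A v, v⟫_ℝ = 0) (hσ : ∀ x : S2, σ x = A x) (x : S2) :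
    roughLaplacian σ x = A x := by
  simp only [roughLaplacian, nabla2_linear hA hσ, inner_stdVec_stdField]
  simp only [stdField_apply, smul_sub, Finset.sum_sub_distrib, smul_smul, sum_inner_stdVec_smul,
    ← Finset.sum_smul, sum_inner_stdVec_mul, inner_coe_self, hA]
  simp
  module

theorem inner_apply_apply_coe (hA : ∀ v, ⟪A v, v⟫_ℝ = 0) (v : E3) :
    ⟪v, A (A v)⟫_ℝ = - ‖A v‖ ^ 2 := by
  rw [← real_inner_self_eq_norm_sq, inner_skew hA, neg_neg]

theorem hasFDerivAt_half_norm_sq (hA : ∀ v, ⟪A v, v⟫_ℝ = 0) (x : E3) :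
    HasFDerivAt (fun y : E3 => ‖A y‖ ^ 2 / 2) (innerSL ℝ (- A (A x))) x := by
  have h := (A.hasFDerivAt (x := x)).norm_sq.mul_const (2 : ℝ)⁻¹
  simp only [← div_eq_mul_inv] at h
  convert! h using 1
  ext1 v
  simp [inner_skew hA (A x) v]

theorem gradHalfNormSq_linear (hA : ∀ v, ⟪A v, v⟫_ℝ = 0) (hσ : ∀ x : S2, σ x = A x) (x : S2) :
    gradHalfNormSq σ x = - A (A x) - ‖A x‖ ^ 2 • (x : E3) := by
  have h : ⟪(x : E3), - A (A x)⟫_ℝ = ‖A x‖ ^ 2 := by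
    rw [inner_neg_right, inner_apply_apply_coe hA, neg_neg]
  rw [gradHalfNormSq, grad_apply_of_hasFDerivAt (fun y => by rw [hσ])
    (hasFDerivAt_half_norm_sq hA x), h]

theorem laplacian_half_norm_sq (hA : ∀ v, ⟪A v, v⟫_ℝ = 0) (hσ : ∀ x : S2, σ x = A x) (x : S2) :
    laplacian (fun y => ‖σ y‖ ^ 2 / 2) x = 3 * ‖A x‖ ^ 2 - ∑ i, ‖A (stdVec i)‖ ^ 2 := by
  -- The factor `2 * (· / 2)` lets `hasFDerivAt_half_norm_sq` be reused.
  have h : HasFDerivAt (fun y : E3 => - A (A y) - (2 * (‖A y‖ ^ 2 / 2)) • y) _ (x : E3) :=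
    ((A.hasFDerivAt.comp (x : E3) A.hasFDerivAt).neg).sub
      (((hasFDerivAt_half_norm_sq hA x).const_mul 2).smul (hasFDerivAt_id (x : E3)))
  have hv : ∀ i, ⟪nabla (grad fun y => ‖σ y‖ ^ 2 / 2) x (stdField i x), stdField i x⟫_ℝ
      = ‖A (stdField i x)‖ ^ 2 - ‖A x‖ ^ 2 * ⟪stdVec i, stdField i x⟫_ℝ := by
    intro i
    have hvi := inner_coe_stdField i x
    have h2 : ⟪stdField i x, stdField i x⟫_ℝ = ⟪stdVec i, stdField i x⟫_ℝ := by
      nth_rewrite 1 [stdField_apply]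
      rw [inner_sub_left, inner_smul_left, hvi, mul_zero, sub_zero]
    rw [nabla_apply_of_hasFDerivAt (σ := grad fun y => ‖σ y‖ ^ 2 / 2)
      (fun y => (gradHalfNormSq_linear hA hσ y).trans (by rw [mul_div_cancel₀ _ two_ne_zero])) h hvi, ← h2]
    simp [inner_sub_left, inner_smul_left, inner_add_left, hvi]
    rw [inner_skew hA, real_inner_self_eq_norm_sq]
    ring
  simp only [laplacian, hv, Finset.sum_sub_distrib, ← Finset.mul_sum, inner_stdVec_stdField,
    sum_inner_stdVec_mul, inner_coe_self, sum_norm_sq_apply_stdField hA]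
  simp
  ring

theorem norm_sq_nabla_linear (hσ : ∀ x : S2, σ x = A x) (i : Fin 3) (x : S2) :
    ‖nabla σ x (stdField i x)‖ ^ 2 =
      ‖A (stdField i x)‖ ^ 2 - ⟪(x : E3), A (stdField i x)⟫_ℝ ^ 2 := by
  rw [nabla_linear hσ x (inner_coe_stdField i x), ← real_inner_self_eq_norm_sq,
    ← real_inner_self_eq_norm_sq]
  simp only [inner_sub_left, inner_sub_right, inner_smul_left, inner_smul_right, inner_coe_self,
    real_inner_comm (x : E3) (A (stdField i x))]
  simp
  ring

theorem normSqNabla_linear (hA : ∀ v, ⟪A v, v⟫_ℝ = 0) (hσ : ∀ x : S2, σ x = A x) (x : S2) :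
    normSqNabla σ x = ∑ i, ‖A (stdVec i)‖ ^ 2 - 2 * ‖A x‖ ^ 2 := by
  simp only [normSqNabla, norm_sq_nabla_linear hσ, Finset.sum_sub_distrib,
    sum_norm_sq_apply_stdField hA, inner_apply_stdField_self hA, neg_sq]
  simp only [pow_two (⟪A x, stdVec _⟫_ℝ), sum_inner_stdVec_mul, real_inner_self_eq_norm_sq]
  ring

theorem exists_apply_stdVec_ne_zero (hA0 : A ≠ 0) : ∃ i, A (stdVec i) ≠ 0 := by
  by_contra! h
  refine hA0 (ContinuousLinearMap.ext fun v => ?_)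
  rw [← sum_inner_stdVec_smul v]
  simp [h]

theorem skew_invariant_pos (hA0 : A ≠ 0) {m : ℝ} (hm1 : ∑ i, ‖A (stdVec i)‖ ^ 2 = 2 * m) :
    0 < m := by
  obtain ⟨i, hi⟩ := exists_apply_stdVec_ne_zero hA0
  have hn : ‖A (stdVec i)‖ ≠ 0 := norm_ne_zero_iff.mpr hi
  have h1 : 0 < ∑ j, ‖A (stdVec j)‖ ^ 2 :=
    Finset.sum_pos' (fun j _ => by positivity) ⟨i, Finset.mem_univ i, by positivity⟩
  linarith

/-- A non-zero skew endomorphism does not solve the Euler-Lagrange equation: the equation fails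
where the length is maximal. -/
theorem not_solvesEulerLagrange_linear {p q : ℝ} (hq : 0 ≤ q) (hA : ∀ v, ⟪A v, v⟫_ℝ = 0)
    (hA0 : A ≠ 0) (hσ : ∀ x : S2, σ x = A x) : ¬ SolvesEulerLagrange p q σ := by
  intro hEL
  obtain ⟨m, hm1, hm2⟩ := exists_skew_invariant hA
  obtain ⟨i, hi⟩ := exists_apply_stdVec_ne_zero hA0
  have hn : ‖A (stdVec i)‖ ≠ 0 := norm_ne_zero_iff.mpr hi
  have hm : 0 < m := skew_invariant_pos hA0 hm1
  -- A unit vector in the range of `A` is orthogonal to `a`, so `‖A x‖²` takes its maximum `m`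
  -- there.
  let x : S2 := ⟨‖A (stdVec i)‖⁻¹ • A (stdVec i), by
    rw [mem_sphere_zero_iff_norm, norm_smul, norm_inv, norm_norm, inv_mul_cancel₀ hn]⟩
  have hs : ‖A x‖ ^ 2 = m := by
    change ‖A (‖A (stdVec i)‖⁻¹ • A (stdVec i))‖ ^ 2 = m
    rw [map_smul, norm_smul, mul_pow, hm2, norm_inv, norm_norm]
    field_simp
  have hX : gradHalfNormSq σ x = 0 := by
    rw [gradHalfNormSq_linear hA hσ, ← norm_eq_zero, ← sq_eq_zero_iff, ← real_inner_self_eq_norm_sq]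
    simp only [inner_sub_left, inner_sub_right, inner_smul_left, inner_smul_right, inner_neg_left,
      inner_neg_right, inner_apply_apply_coe hA, real_inner_self_eq_norm_sq,
      real_inner_comm (x : E3) (A (A x)), hm2, hs]
    simp
  have hσ0 : A x ≠ 0 := by
    rw [← norm_ne_zero_iff, ← pow_ne_zero_iff two_ne_zero, hs]
    exact hm.ne'
  have h := hEL x
  rw [hX, roughLaplacian_linear hA hσ, normSqNabla_linear hA hσ, laplacian_half_norm_sq hA hσ, hσ,
    hs, hm1, map_zero, smul_zero, add_zero, norm_zero] at h
  have h2 := smul_left_injective ℝ hσ0 h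
  have h3 : (1 + m) * (1 + q * m) = 0 := by linear_combination h2
  have h4 : 0 < (1 + m) * (1 + q * m) := by positivity
  exact h4.ne' h3

end Skew

/-! ### Differentiating the energy -/

/-- Differentiation under the integral sign over a compact space. -/
theorem hasDerivAt_integral_of_continuous {X : Type*} [TopologicalSpace X] [CompactSpace X]
    [MeasurableSpace X] [OpensMeasurableSpace X] {μ : MeasureTheory.Measure X}
    [MeasureTheory.IsFiniteMeasure μ] {F F' : ℝ → X → ℝ} (hF : ∀ t, Continuous (F t))
    (hF' : Continuous (fun z : ℝ × X => F' z.1 z.2))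
    (hd : ∀ t x, HasDerivAt (fun s => F s x) (F' t x) t) (t₀ : ℝ) :
    HasDerivAt (fun t => ∫ x, F t x ∂μ) (∫ x, F' t₀ x ∂μ) t₀ := by
  have hc : IsCompact (Metric.closedBall t₀ 1 ×ˢ (Set.univ : Set X)) :=
    (isCompact_closedBall t₀ 1).prod isCompact_univ
  obtain ⟨C, hC⟩ := hc.exists_bound_of_continuousOn hF'.continuousOn
  have hF'0 : Continuous (F' t₀) := hF'.comp (by fun_prop : Continuous fun x : X => (t₀, x))
  exact (hasDerivAt_integral_of_dominated_loc_of_deriv_le (F := F) (F' := F') (bound := fun _ => C)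
    (Metric.closedBall_mem_nhds t₀ one_pos)
    (Filter.Eventually.of_forall fun t => (hF t).aestronglyMeasurable)
    ((hF t₀).integrable_of_hasCompactSupport (HasCompactSupport.of_compactSpace _))
    hF'0.aestronglyMeasurable
    (Filter.Eventually.of_forall fun x t ht => hC (t, x) ⟨ht, Set.mem_univ x⟩)
    (MeasureTheory.integrable_const C)
    (Filter.Eventually.of_forall fun x t _ => hd t x)).2

/-! ### Energy density of rescaled linear fields -/

section Skew

variable {A : E3 →L[ℝ] E3} {τ : S2 → E3}

theorem nabla_rescaled (hA : ∀ v, ⟪A v, v⟫_ℝ = 0) {c : ℝ → ℝ}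
    (hτ : ∀ x : S2, τ x = c (‖A x‖ ^ 2 / 2) • A x) (x : S2) {c' : ℝ}
    (hc : HasDerivAt c c' (‖A x‖ ^ 2 / 2)) {v : E3} (hv : ⟪(x : E3), v⟫_ℝ = 0) :
    nabla τ x v = c (‖A x‖ ^ 2 / 2) • (A v - ⟪(x : E3), A v⟫_ℝ • (x : E3))
      + (c' * ⟪A v, A x⟫_ℝ) • A x := by
  have h : HasFDerivAt (fun y : E3 => c (‖A y‖ ^ 2 / 2) • A y) _ (x : E3) :=
    (HasDerivAt.comp_hasFDerivAt (x : E3) hc (hasFDerivAt_half_norm_sq hA x)).smul A.hasFDerivAt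
  rw [nabla_apply_of_hasFDerivAt hτ h hv]
  simp [inner_add_right, inner_smul_right, inner_coe_skew hA, inner_skew hA (A x) v,
    real_inner_comm (A x) (A v)]
  module

/-- By Leibniz only `|∇_{E i} σ|²` and `⟪A (E i), A x⟫²` enter; they sum to `2(m - s)` and `s(m -
s)`, whence the common factor `m - s`. -/
theorem normSqVerticalDiff_rescaled (hA : ∀ v, ⟪A v, v⟫_ℝ = 0) {c : ℝ → ℝ}
    (hτ : ∀ x : S2, τ x = c (‖A x‖ ^ 2 / 2) • A x) (p q : ℝ) (x : S2) {c' k s m : ℝ}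
    (hc : HasDerivAt c c' (‖A x‖ ^ 2 / 2)) (hk : c (‖A x‖ ^ 2 / 2) = k) (hs : ‖A x‖ ^ 2 = s)
    (hm1 : ∑ i, ‖A (stdVec i)‖ ^ 2 = 2 * m) (hm2 : ∀ v, ‖A (A v)‖ ^ 2 = m * ‖A v‖ ^ 2) :
    normSqVerticalDiff p q τ x = ((1 + k ^ 2 * s)⁻¹) ^ p * ((m - s) *
      (2 * k ^ 2 + (2 * k * c' + c' ^ 2 * s + q * k ^ 2 * (k + c' * s) ^ 2) * s)) := by
  have hN : ∑ i, (‖A (stdField i x)‖ ^ 2 - ⟪(x : E3), A (stdField i x)⟫_ℝ ^ 2) = 2 * (m - s) := by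
    have h := normSqNabla_linear (σ := fun x => A x) hA (fun _ => rfl) x
    simp only [normSqNabla, norm_sq_nabla_linear (σ := fun x => A x) (A := A) (fun _ => rfl)] at h
    rw [h, hm1, hs]
    ring
  have hY := sum_inner_apply_stdField_sq hA x
  rw [hm2, hs] at hY
  have hτn : ‖τ x‖ ^ 2 = k ^ 2 * s := by
    rw [hτ, hk, norm_smul, mul_pow, hs, Real.norm_eq_abs, sq_abs]
  have hterm : ∀ i, verticalMetric p q (τ x) (nabla τ x (stdField i x)) (nabla τ x (stdField i x))
      = ((1 + k ^ 2 * s)⁻¹) ^ p *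
        (k ^ 2 * (‖A (stdField i x)‖ ^ 2 - ⟪(x : E3), A (stdField i x)⟫_ℝ ^ 2)
        + (2 * k * c' + c' ^ 2 * s + q * k ^ 2 * (k + c' * s) ^ 2)
          * ⟪A (stdField i x), A x⟫_ℝ ^ 2) := by
    intro i
    rw [verticalMetric, hτn, nabla_rescaled hA hτ x hc (inner_coe_stdField i x), hτ, hk]
    congr 1
    simp only [inner_add_left, inner_add_right, inner_sub_left, inner_sub_right, inner_smul_left,
      inner_smul_right, inner_coe_skew hA, hA, real_inner_self_eq_norm_sq, hs,
      real_inner_comm (x : E3) (A (stdField i x)), real_inner_comm (A (stdField i x)) (A x)]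
    simp
    ring
  simp only [normSqVerticalDiff, hterm, ← Finset.mul_sum, Finset.sum_add_distrib, hN, hY]
  ring

/-- The difference `m - ‖A x‖²` is half of `|∇σ|²`. -/
theorem norm_sq_apply_coe_le (hA : ∀ v, ⟪A v, v⟫_ℝ = 0) {m : ℝ}
    (hm1 : ∑ i, ‖A (stdVec i)‖ ^ 2 = 2 * m) (x : S2) : ‖A x‖ ^ 2 ≤ m := by
  have h := normSqNabla_linear (σ := fun x => A x) hA (fun _ => rfl) x
  have h0 : 0 ≤ normSqNabla (fun x => A x) x := Finset.sum_nonneg fun i _ => by positivity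
  linarith

/-- Otherwise the three basis vectors alone would give `3m ≤ 2m`. -/
theorem exists_norm_sq_apply_coe_lt {m : ℝ} (hm : 0 < m)
    (hm1 : ∑ i, ‖A (stdVec i)‖ ^ 2 = 2 * m) : ∃ x : S2, ‖A x‖ ^ 2 < m := by
  by_contra! h
  have h1 : ∀ i, m ≤ ‖A (stdVec i)‖ ^ 2 := fun i => h ⟨stdVec i, by simp [stdVec]⟩
  have h2 := Finset.sum_le_sum fun i (_ : i ∈ Finset.univ) => h1 i
  rw [hm1] at h2
  simp at h2
  linarith

end Skew

/-! ### The test variation -/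

/-- The variation of the field `A` used to test criticality. -/
noncomputable def testVariation (p : ℝ) (A : E3 →L[ℝ] E3) (t : ℝ) (x : S2) : E3 :=
  (1 + t * Real.exp (p * ‖A x‖ ^ 2)) • A x

theorem isVariation_testVariation (p : ℝ) {A : E3 →L[ℝ] E3} (hA : ∀ v, ⟪A v, v⟫_ℝ = 0)
    {σ : S2 → E3} (hσ : ∀ x : S2, σ x = A x) : IsVariation σ (testVariation p A) where
  smooth := by
    have : Fact (Module.finrank ℝ E3 = 2 + 1) := ⟨by simp⟩
    have h1 : ContDiff ℝ ∞
        (fun z : ℝ × E3 => (1 + z.1 * Real.exp (p * ‖A z.2‖ ^ 2)) • A z.2) := by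
      have h2 : ContDiff ℝ ∞ fun z : ℝ × E3 => A z.2 := A.contDiff.comp contDiff_snd
      exact (contDiff_const.add (contDiff_fst.mul
        (contDiff_const.mul (h2.norm_sq ℝ)).exp)).smul h2
    have h3 : ContMDiff (𝓘(ℝ, ℝ).prod (𝓡 2)) 𝓘(ℝ, ℝ × E3) ∞
        (fun z : ℝ × S2 => (z.1, (z.2 : E3))) :=
      contMDiff_fst.prodMk_space ((contMDiff_coe_sphere (n := 2)).comp contMDiff_snd)
    exact h1.comp_contMDiff h3
  tangent t x := by rw [testVariation, inner_smul_right, inner_coe_skew hA, mul_zero]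
  start := by
    funext x
    simp [testVariation, hσ]

/-- The vertical energy density along the test variation, as a function of `t` and `s = |A x|²`. -/
noncomputable def testDensity (p q m t s : ℝ) : ℝ :=
  ((1 + (1 + t * Real.exp (p * s)) ^ 2 * s)⁻¹) ^ p * ((m - s) *
    (2 * (1 + t * Real.exp (p * s)) ^ 2
      + (2 * (1 + t * Real.exp (p * s)) * (t * (2 * p * Real.exp (p * s)))
        + (t * (2 * p * Real.exp (p * s))) ^ 2 * s
        + q * (1 + t * Real.exp (p * s)) ^ 2
          * (1 + t * Real.exp (p * s) + t * (2 * p * Real.exp (p * s)) * s) ^ 2) * s))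

/-- The derivative of `testDensity` in `t`, where `e = exp (p s)`, `k = 1 + t e` and
`d = 2 p t e`. -/
noncomputable def testDensityDeriv (p q m s e k d : ℝ) : ℝ :=
  -(2 * k * e * s) / (1 + k ^ 2 * s) ^ 2 * p * ((1 + k ^ 2 * s)⁻¹) ^ (p - 1) * ((m - s) *
    (2 * k ^ 2 + (2 * k * d + d ^ 2 * s + q * k ^ 2 * (k + d * s) ^ 2) * s))
  + ((1 + k ^ 2 * s)⁻¹) ^ p * ((m - s) *
    (4 * k * e + (2 * e * d + 2 * k * (2 * p * e) + 2 * d * (2 * p * e) * s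
      + q * (2 * k * e) * (k + d * s) ^ 2
      + q * k ^ 2 * (2 * (k + d * s) * (e + 2 * p * e * s))) * s))

theorem hasDerivAt_testDensity (p q m t : ℝ) {s : ℝ} (hs : 0 ≤ s) :
    HasDerivAt (fun t => testDensity p q m t s)
      (testDensityDeriv p q m s (Real.exp (p * s)) (1 + t * Real.exp (p * s))
        (t * (2 * p * Real.exp (p * s)))) t := by
  unfold testDensity testDensityDeriv
  generalize Real.exp (p * s) = e
  have hk : HasDerivAt (fun t => 1 + t * e) e t := by
    simpa using ((hasDerivAt_id t).mul_const e).const_add 1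
  have hd : HasDerivAt (fun t => t * (2 * p * e)) (2 * p * e) t := by
    simpa using (hasDerivAt_id t).mul_const (2 * p * e)
  have hpos : 0 < 1 + (1 + t * e) ^ 2 * s := by positivity
  have hw := ((((hk.pow 2).mul_const s).const_add 1).fun_inv hpos.ne').rpow_const (p := p)
    (Or.inl (inv_pos.mpr hpos).ne')
  have hkd := (hk.add (hd.mul_const s)).pow 2
  have hK := (((hk.pow 2).const_mul 2).add ((((hk.const_mul 2).mul hd).add
    ((hd.pow 2).mul_const s) |>.add (((hk.pow 2).const_mul q).mul hkd)).mul_const s)).const_mul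
      (m - s)
  convert! hw.mul hK using 1
  simp only [Pi.pow_apply, Pi.add_apply, Pi.mul_apply, Nat.cast_ofNat, Nat.add_one_sub_one, pow_one]
  ring

theorem continuous_testDensity (p q m t : ℝ) {X : Type*} [TopologicalSpace X] {s : X → ℝ}
    (hs : Continuous s) (hs0 : ∀ x, 0 ≤ s x) : Continuous fun x => testDensity p q m t (s x) := by
  unfold testDensity
  have h : ∀ x, 0 < 1 + (1 + t * Real.exp (p * s x)) ^ 2 * s x := fun x => by
    have := hs0 x
    positivity
  refine Continuous.mul (Continuous.rpow_const (Continuous.inv₀ (by fun_prop) fun x => (h x).ne')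
    fun x => Or.inl (inv_pos.mpr (h x)).ne') (by fun_prop)

theorem continuous_testDensityDeriv (p q m : ℝ) {X : Type*} [TopologicalSpace X]
    {s e k d : X → ℝ} (hs : Continuous s) (hs0 : ∀ x, 0 ≤ s x) (he : Continuous e)
    (hk : Continuous k) (hd : Continuous d) :
    Continuous fun x => testDensityDeriv p q m (s x) (e x) (k x) (d x) := by
  unfold testDensityDeriv
  have h : ∀ x, 0 < 1 + k x ^ 2 * s x := fun x => by
    have := hs0 x
    positivity
  have hr : ∀ r : ℝ, Continuous fun x => ((1 + k x ^ 2 * s x)⁻¹) ^ r := fun r =>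
    Continuous.rpow_const (Continuous.inv₀ (by fun_prop) fun x => (h x).ne')
      fun x => Or.inl (inv_pos.mpr (h x)).ne'
  have hr1 := hr p
  have hr2 := hr (p - 1)
  have hq : Continuous fun x => -(2 * k x * e x * s x) / (1 + k x ^ 2 * s x) ^ 2 :=
    Continuous.div (by fun_prop) (by fun_prop) fun x => (pow_pos (h x) 2).ne'
  exact (((hq.mul continuous_const).mul hr2).mul (by fun_prop)).add (hr1.mul (by fun_prop))

/-- This form exhibits the sign. The weight contributes `-2ps(2 + qs)/(1 + s)`, and the growth of
`exp(p s)` contributes `4ps + 4pqs²`; their sum is the last bracket, with all coefficients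
nonnegative when `p, q ≥ 0`. -/
theorem testDensityDeriv_zero_eq (p q m : ℝ) {s e : ℝ} (hs : 0 ≤ s) :
    testDensityDeriv p q m s e 1 0 = (m - s) * (e * ((1 + s)⁻¹) ^ p *
      (4 + 4 * q * s + (1 + s)⁻¹ * (4 * p * s ^ 2 + 2 * p * q * s ^ 2 + 4 * p * q * s ^ 3))) := by
  have h : 0 < 1 + s := by linarith
  have hr : ((1 + s)⁻¹) ^ p = ((1 + s)⁻¹) ^ (p - 1) * (1 + s)⁻¹ := by
    rw [Real.rpow_sub_one (inv_pos.mpr h).ne']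
    field_simp
  unfold testDensityDeriv
  simp only [one_pow, one_mul, hr]
  field_simp
  ring

theorem verticalEnergy_testVariation (p q : ℝ) {A : E3 →L[ℝ] E3} (hA : ∀ v, ⟪A v, v⟫_ℝ = 0) {m : ℝ}
    (hm1 : ∑ i, ‖A (stdVec i)‖ ^ 2 = 2 * m) (hm2 : ∀ v, ‖A (A v)‖ ^ 2 = m * ‖A v‖ ^ 2) (t : ℝ) :
    verticalEnergy p q (testVariation p A t) =
      1 / 2 * ∫ x : S2, testDensity p q m t (‖A x‖ ^ 2) ∂area := by
  rw [verticalEnergy]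
  congr 2
  funext x
  -- The profile is a function of `h = s / 2`, hence the exponent `2 * p * h`.
  have hc : ∀ h : ℝ, HasDerivAt (fun h => 1 + t * Real.exp (2 * p * h))
      (t * (2 * p * Real.exp (2 * p * h))) h := by
    intro h
    have h1 : HasDerivAt (fun h => 2 * p * h) (2 * p) h := by
      simpa using (hasDerivAt_id h).const_mul (2 * p)
    convert! (h1.exp.const_mul t).const_add 1 using 1
    ring
  have he : ∀ y : S2, 2 * p * (‖A y‖ ^ 2 / 2) = p * ‖A y‖ ^ 2 := fun y => by ring
  rw [normSqVerticalDiff_rescaled (c := fun h => 1 + t * Real.exp (2 * p * h)) hA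
    (fun y => by rw [testVariation, he]) p q x (hc _) rfl rfl hm1 hm2, he]
  rfl

/-- A non-zero skew endomorphism is not a critical point of the vertical energy: the energy
increases along the test variation. -/
theorem not_isCriticalSection_linear {p q : ℝ} (hp : 0 < p) (hq : 0 ≤ q) {A : E3 →L[ℝ] E3}
    (hA : ∀ v, ⟪A v, v⟫_ℝ = 0) (hA0 : A ≠ 0) {σ : S2 → E3} (hσ : ∀ x : S2, σ x = A x) :
    ¬ IsCriticalSection p q σ := by
  intro hcrit
  obtain ⟨m, hm1, hm2⟩ := exists_skew_invariant hA
  obtain ⟨x₁, hx₁⟩ := exists_norm_sq_apply_coe_lt (skew_invariant_pos hA0 hm1) hm1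
  have : MeasureTheory.IsFiniteMeasure area :=
    inferInstanceAs (MeasureTheory.IsFiniteMeasure MeasureTheory.volume.toSphere)
  have : area.IsOpenPosMeasure :=
    inferInstanceAs (MeasureTheory.volume : MeasureTheory.Measure E3).toSphere.IsOpenPosMeasure
  have hsc : Continuous fun x : S2 => ‖A x‖ ^ 2 := by fun_prop
  have hs0 : ∀ x : S2, 0 ≤ ‖A x‖ ^ 2 := fun x => by positivity
  have hsc' : Continuous fun z : ℝ × S2 => ‖A z.2‖ ^ 2 := hsc.comp continuous_snd
  have hd := hasDerivAt_integral_of_continuous (μ := area)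
    (F := fun t (x : S2) => testDensity p q m t (‖A x‖ ^ 2))
    (fun t => continuous_testDensity p q m t hsc hs0)
    (continuous_testDensityDeriv p q m hsc' (fun z => hs0 z.2) (by fun_prop) (by fun_prop)
      (by fun_prop))
    (fun t x => hasDerivAt_testDensity p q m t (hs0 x)) 0
  have h1 := hcrit _ (isVariation_testVariation p hA hσ)
  simp only [verticalEnergy_testVariation p q hA hm1 hm2] at h1
  have h2 := h1.unique (hd.const_mul (1 / 2))
  simp only [zero_mul, add_zero, testDensityDeriv_zero_eq p q m (hs0 _)] at h2
  have hpos : ∀ x : S2, 0 < Real.exp (p * ‖A x‖ ^ 2) * ((1 + ‖A x‖ ^ 2)⁻¹) ^ p *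
      (4 + 4 * q * ‖A x‖ ^ 2 + (1 + ‖A x‖ ^ 2)⁻¹ * (4 * p * (‖A x‖ ^ 2) ^ 2
        + 2 * p * q * (‖A x‖ ^ 2) ^ 2 + 4 * p * q * (‖A x‖ ^ 2) ^ 3)) := fun x => by positivity
  -- The integrand is continuous, nonnegative since `s ≤ m`, and nonzero at `x₁`; `area` charges
  -- open sets, so the integral is positive.
  refine h2.not_lt (mul_pos (by norm_num) ?_)
  refine Continuous.integral_pos_of_hasCompactSupport_nonneg_nonzero (x := x₁) ?_
    (HasCompactSupport.of_compactSpace _) ?_ ?_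
  · have h3 := continuous_testDensityDeriv (X := S2) p q m hsc hs0
      (e := fun x : S2 => Real.exp (p * ‖A x‖ ^ 2))
      (by fun_prop) (continuous_const (y := 1)) (continuous_const (y := 0))
    simpa only [testDensityDeriv_zero_eq p q m (hs0 _)] using h3
  · intro x
    exact mul_nonneg (sub_nonneg.mpr (norm_sq_apply_coe_le hA hm1 x)) (hpos x).le
  · exact (mul_pos (sub_pos.mpr hx₁) (hpos x₁)).ne'

end RoundSphere

theorem mainTheorem2 (p q : ℝ) (hp : 0 < p) (hq : 0 ≤ q) :
    ¬ ∃ σ : RoundSphere.S2 → RoundSphere.E3,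
      RoundSphere.IsVectorField σ ∧ σ ≠ 0 ∧ RoundSphere.IsKilling σ ∧
        (RoundSphere.IsCriticalSection p q σ ∨ RoundSphere.SolvesEulerLagrange p q σ) := by
  rintro ⟨σ, hσ, h0, hK, h⟩
  obtain ⟨A, hA, hσA⟩ := RoundSphere.IsKilling.exists_skew hσ hK
  have hA0 : A ≠ 0 := by
    rintro rfl
    exact h0 (funext fun x => by simp [hσA])
  rcases h with h | h
  · exact RoundSphere.not_isCriticalSection_linear hp hq hA hA0 hσA h
  · exact RoundSphere.not_solvesEulerLagrange_linear hq hA hA0 hσA h
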